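/- The following decision problem is undecidable. Input: a natural number $k$; a dimension $d\ge 1$; a semialgebraic set $S\subseteq\mathbb{R}^d$, given by a quantifier-free description, i.e. as a finite union of solution sets of finite systems of polynomial equations $p=0$ and strict inequalities $q>0$ with rational coefficients; a matrix $M\in\mathbb{Q}^{d\times d}$; and a hyperplane $H=\{z\in\mathbb{R}^d : \langle h,z\rangle=c\}$ with $h\in\mathbb{Q}^d\setminus\{0\}$ and $c\in\mathbb{Q}$. Question: is there a point $x\in S$ such that the orbit $x, Mx, M^2x,\ldots$ hits $H$ at least $k$ times? That is, there is no algorithm which answers this question correctly for all such inputs. This holds both when "$k$ times" means that $M^nx\in H$ for at least $k$ indices $n\in\mathbb{N}$, and when it means that the set $\{M^nx : n\in\mathbb{N}\}\cap H$ has at least $k$ elements. In both cases it also holds when only hyperplanes through the origin ($c=0$) are allowed as inputs. -/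

import Mathlib

namespace OrbitHits

/-! ### Finite descriptions of the input data -/

/-- A code of a rational number: `(a, b)` stands for `a / (b + 1)`. -/
abbrev RatCode := ℤ × ℕ

/-- The rational number described by a code. -/
def ratVal (q : RatCode) : ℚ := (q.1 : ℚ) / ((q.2 : ℚ) + 1)

/-- A monomial with rational coefficient: the coefficient and the list of the exponents of
the variables, in order. -/
abbrev MonomialCode := RatCode × List ℕ

/-- A polynomial with rational coefficients: the list of the monomials that it is the sum of. -/
abbrev PolyCode := List MonomialCode

/-- A finite system of polynomial equations `p = 0` (first list) and strict polynomial
inequalities `q > 0` (second list). -/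
abbrev SystemCode := List PolyCode × List PolyCode

/-- A quantifier-free description of a semialgebraic set, in disjunctive normal form: a finite
list of systems of polynomial equations and inequalities, of which at least one has to hold. -/
abbrev SemialgCode := List SystemCode

/-- The value at `x : ℝ^d` of the monomial with the given code. -/
noncomputable def monomialEval {d : ℕ} (m : MonomialCode) (x : Fin d → ℝ) : ℝ :=
  (ratVal m.1 : ℝ) * ∏ i : Fin d, x i ^ (m.2.getD i 0)

/-- The value at `x : ℝ^d` of the polynomial with the given code. -/
noncomputable def polyEval {d : ℕ} (p : PolyCode) (x : Fin d → ℝ) : ℝ :=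
  (p.map fun m => monomialEval m x).sum

/-- The set of solutions in `ℝ^d` of a system of equations and strict inequalities. -/
def systemSet (d : ℕ) (s : SystemCode) : Set (Fin d → ℝ) :=
  {x | (∀ p ∈ s.1, polyEval p x = 0) ∧ (∀ q ∈ s.2, 0 < polyEval q x)}

/-- The semialgebraic subset of `ℝ^d` with the given description. -/
def semialgSet (d : ℕ) (S : SemialgCode) : Set (Fin d → ℝ) :=
  {x | ∃ s ∈ S, x ∈ systemSet d s}

/-- An input of the decision problem, as finite data: the number `k`, the dimension `d`, a
description of a semialgebraic set, the rows of a matrix, and the normal vector and the offset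
of a hyperplane. -/
structure Input where
  /-- the required number of hits -/
  k : ℕ
  /-- the dimension of the ambient space -/
  dim : ℕ
  /-- the description of the set of initial points -/
  initial : SemialgCode
  /-- the rows of the matrix -/
  rows : List (List RatCode)
  /-- the normal vector of the hyperplane -/
  normal : List RatCode
  /-- the offset of the hyperplane -/
  offset : RatCode

/-- Inputs are tuples of finite data. -/
def Input.equivProd :
    Input ≃ ℕ × ℕ × SemialgCode × List (List RatCode) × List RatCode × RatCode where
  toFun I := (I.k, I.dim, I.initial, I.rows, I.normal, I.offset)
  invFun t := ⟨t.1, t.2.1, t.2.2.1, t.2.2.2.1, t.2.2.2.2.1, t.2.2.2.2.2⟩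
  left_inv _ := rfl
  right_inv _ := rfl

/-- The coding of inputs by natural numbers that comes from the standard coding of tuples and
lists. -/
noncomputable instance Input.instPrimcodable : Primcodable Input :=
  Primcodable.ofEquiv _ Input.equivProd

namespace Input

/-! ### The objects that an input describes -/

/-- The set `S ⊆ ℝ^d` of initial points. -/
def initialSet (I : Input) : Set (Fin I.dim → ℝ) := semialgSet I.dim I.initial

/-- The rational `d × d` matrix `M`. -/
def matrix (I : Input) : Matrix (Fin I.dim) (Fin I.dim) ℚ :=
  Matrix.of fun i j => ratVal ((I.rows.getD i []).getD j (0, 0))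

/-- The rational normal vector of the hyperplane. -/
def normalVec (I : Input) : Fin I.dim → ℚ := fun i => ratVal (I.normal.getD i (0, 0))

/-- The hyperplane `H = {z | ⟨h, z⟩ = c}` in `ℝ^d`. -/
def hyperplane (I : Input) : Set (Fin I.dim → ℝ) :=
  {z | (fun i => (I.normalVec i : ℝ)) ⬝ᵥ z = (ratVal I.offset : ℝ)}

/-- The orbit `x, Mx, M²x, …` of a point `x : ℝ^d`. -/
noncomputable def orbit (I : Input) (x : Fin I.dim → ℝ) (n : ℕ) : Fin I.dim → ℝ :=
  Matrix.mulVec ((I.matrix.map fun q : ℚ => (q : ℝ)) ^ n) x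

/-- The exponent lists in a description of a semialgebraic set all have length `d`. -/
def InitialWellFormed (I : Input) : Prop :=
  ∀ s ∈ I.initial, ∀ p ∈ s.1 ++ s.2, ∀ m ∈ p, m.2.length = I.dim

/-- The input is a proper one: all lists have the sizes prescribed by the dimension `d`, and the
normal vector is not zero, so that `H` really is a hyperplane (in particular `d ≥ 1`). -/
structure WellFormed (I : Input) : Prop where
  initial_wf : I.InitialWellFormed
  rows_length : I.rows.length = I.dim
  row_length : ∀ r ∈ I.rows, r.length = I.dim
  normal_length : I.normal.length = I.dim
  normal_ne_zero : I.normalVec ≠ 0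

/-- The hyperplane of the input passes through the origin. -/
def Homogeneous (I : Input) : Prop := ratVal I.offset = 0

/-- Some point of `S` has an orbit that is in `H` for at least `k` indices `n`. -/
def HitsAtLeast (I : Input) : Prop :=
  ∃ x ∈ I.initialSet, (I.k : ℕ∞) ≤ {n : ℕ | I.orbit x n ∈ I.hyperplane}.encard

/-- Some point of `S` has an orbit with at least `k` distinct points in `H`. -/
def MeetsInAtLeast (I : Input) : Prop :=
  ∃ x ∈ I.initialSet, (I.k : ℕ∞) ≤ (Set.range (I.orbit x) ∩ I.hyperplane).encard

end Input

/-- The problem of deciding `P` for inputs that satisfy `V` is algorithmically solvable: some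
total computable function answers correctly on every such input (its answers on other inputs do
not matter). -/
def DecidableFor (V P : Input → Prop) : Prop :=
  ∃ f : Input → Bool, Computable f ∧ ∀ I : Input, V I → (f I = true ↔ P I)

end OrbitHits

/-! Counting hits can force real unknowns to be natural numbers. Given reals `y 0 < … < y n`,
suppose that the orbit is in `H` at time `t` exactly when `∏ i, (t - y i) = 0`. Then there are at
least `n + 1` hits iff every `y i` is a natural number (`encard_hits`). A linear map produces this
product if all partial products over index sets `T` are carried along, since `∏ i ∈ T, (z i + 1)` is
the sum of `∏ i ∈ S, z i` over `S ⊆ T` (`orbit_input`).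

The set `S` imposes the product relations, the order of the `y i`, `y 0 = a + 1`, and `P = 0` at `a`
and the gaps `y (i + 1) - y i - 1`. So the answer is yes iff `P (a, t) = 0` is solvable in natural
numbers (`hitsAtLeast_input_iff`). Only `n` and `P` are fixed; `a` varies. The coordinate `t - y 0`
makes the orbit injective, so hits and distinct points in `H` agree. The hyperplane is a coordinate
hyperplane, which settles `c = 0` too.

By the MRDP theorem (`Dioph.diophGraph_of_partrec`), a suitable `P` expresses halting of the program
with code `a`. Its main step is the elimination of bounded universal quantifiers
(`BoundedQuantifier.forall_lt_exists_iff`). -/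

/-! ### Binomial coefficients and factorials in terms of powers, quotients and remainders. -/

theorem Nat.sum_mul_pow_div_mod {B : ℕ} (m k : ℕ) (f : ℕ → ℕ) (hf : ∀ i, f i < B) :
    (∑ i ∈ Finset.range m, f i * B ^ i) / B ^ k % B = if k < m then f k else 0 := by
  have hB : 0 < B := (Nat.zero_le _).trans_lt (hf 0)
  induction k generalizing m f with
  | zero =>
    cases m with
    | zero => simp
    | succ m =>
      rw [Finset.sum_range_succ']
      simp only [pow_succ, ← mul_assoc, ← Finset.sum_mul]
      simp [Nat.mod_eq_of_lt (hf 0)]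
  | succ k ih =>
    cases m with
    | zero => simp
    | succ m =>
      rw [Finset.sum_range_succ', pow_succ', ← Nat.div_div_eq_div_mul]
      simp only [pow_succ, ← mul_assoc, ← Finset.sum_mul]
      rw [pow_zero, mul_one, mul_comm, Nat.mul_add_div hB, Nat.div_eq_of_lt (hf 0), add_zero,
        ih m (fun i => f (i + 1)) (fun i => hf _)]
      simp

/-- In base `B = 2 ^ (n + 1)`, which exceeds every `n.choose i`, the digits of `(B + 1) ^ n` are the
binomial coefficients. -/
theorem Nat.choose_eq_div_mod (n k : ℕ) :
    n.choose k = (2 ^ (n + 1) + 1) ^ n / (2 ^ (n + 1)) ^ k % 2 ^ (n + 1) := by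
  have h : (2 ^ (n + 1) + 1) ^ n =
      ∑ i ∈ Finset.range (n + 1), n.choose i * (2 ^ (n + 1)) ^ i := by
    rw [add_pow]
    exact Finset.sum_congr rfl fun i _ => by simp [mul_comm]
  rw [h, Nat.sum_mul_pow_div_mod]
  · split_ifs with hk
    · rfl
    · exact Nat.choose_eq_zero_of_lt (by omega)
  · exact fun i => (Nat.choose_le_two_pow n i).trans_lt (Nat.pow_lt_pow_right (by simp) (by simp))

open Nat in
-- The quotient `r ^ n / r.choose n` is `n !` times `r ^ n / r.descFactorial n`, a ratio that tends
-- to `1` from above. Bernoulli's inequality for `(1 - n / r) ^ n` shows that for this `r` the error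
-- stays below `1`.
theorem Nat.factorial_eq_pow_div_choose {n r : ℕ} (hr : n ^ 2 * (n ! + 1) < r) :
    n ! = r ^ n / r.choose n := by
  have hr0 : 0 < r := (Nat.zero_le _).trans_lt hr
  have hnr : n ≤ r := by nlinarith [Nat.zero_le (n !)]
  have hd := Nat.descFactorial_eq_factorial_mul_choose r n
  symm
  rw [Nat.div_eq_iff (Nat.choose_pos hnr)]
  have h1 : n ! * r ^ n < (n ! + 1) * r.descFactorial n := by
    have h2 : (r - n) ^ n ≤ r.descFactorial n :=
      (Nat.pow_le_pow_left (by omega) n).trans (Nat.pow_sub_le_descFactorial r n)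
    refine lt_of_lt_of_le ?_ (Nat.mul_le_mul_left _ h2)
    have hR : (0 : ℝ) < r := by exact_mod_cast hr0
    have hb := one_add_mul_le_pow (a := -(n : ℝ) / r)
      (by rw [le_div_iff₀ hR]; have : (n : ℝ) ≤ r := by exact_mod_cast hnr
          linarith) n
    have hr' : (n : ℝ) ^ 2 * (n ! + 1) < r := by exact_mod_cast hr
    have h3 : ((n ! : ℝ)) < (n ! + 1) * (1 + -(n : ℝ) / r) ^ n := by
      refine lt_of_lt_of_le ?_ (mul_le_mul_of_nonneg_left hb (by positivity))
      have : (n : ℝ) ^ 2 * (n ! + 1) / r < 1 := (div_lt_one hR).2 hr'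
      have e : ((n ! : ℝ) + 1) * (1 + n * (-(n : ℝ) / r)) =
        n ! + 1 - (n : ℝ) ^ 2 * (n ! + 1) / r := by field_simp; ring
      rw [e]; linarith
    have h4 : (n ! : ℝ) * r ^ n < (n ! + 1) * (r - n) ^ n := by
      have := mul_lt_mul_of_pos_right h3 (pow_pos hR n)
      have e : (1 + -(n : ℝ) / r) * r = r - n := by field_simp; ring
      rwa [mul_assoc, ← mul_pow, e] at this
    have : ((n ! * r ^ n : ℕ) : ℝ) < (((n ! + 1) * (r - n) ^ n : ℕ) : ℝ) := by
      push_cast [Nat.cast_sub hnr]; exact h4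
    exact_mod_cast this
  constructor
  · rw [← hd]; exact Nat.descFactorial_le_pow r n
  · rw [hd, ← mul_assoc, mul_comm _ (n !), mul_assoc] at h1
    have := lt_of_mul_lt_mul_left h1 (Nat.zero_le _)
    have hc := Nat.choose_pos hnr
    have e : n ! * r.choose n + r.choose n = (n ! + 1) * r.choose n := by ring
    omega

open Nat in
theorem Nat.factorial_eq_pow_div_choose' (n : ℕ) :
    n ! = ((n + 1) ^ 2 * ((n + 1) ^ n + 1)) ^ n /
      ((n + 1) ^ 2 * ((n + 1) ^ n + 1)).choose n := by
  refine Nat.factorial_eq_pow_div_choose ?_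
  have h : n ! ≤ (n + 1) ^ n := (Nat.factorial_le_pow n).trans (Nat.pow_le_pow_left (by simp) n)
  exact Nat.mul_lt_mul_of_lt_of_le (Nat.pow_lt_pow_left (by simp) (by simp)) (by omega) (by simp)

/-! ### Elimination of a bounded universal quantifier. -/

namespace BoundedQuantifier

open Nat

/-- The moduli `(q!² - (k + 1)) / (k + 1)`, whose product over `k < y` is a binomial coefficient. -/
def modulus (q k : ℕ) : ℕ := q ! * (q ! / (k + 1)) - 1

variable {q y : ℕ}

theorem modulus_pos_aux {k : ℕ} (hk : k < q) : 0 < q ! / (k + 1) :=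
  Nat.div_pos (Nat.le_of_dvd (factorial_pos q) (Nat.dvd_factorial (by simp) hk)) (by simp)

theorem succ_mul_modulus {k : ℕ} (hk : k < q) : (k + 1) * modulus q k = q ! ^ 2 - 1 - k := by
  have h := Nat.mul_div_cancel' (Nat.dvd_factorial (Nat.succ_pos k) hk)
  rw [modulus, Nat.mul_sub, mul_left_comm, h, sq]
  omega

theorem two_le_modulus {k : ℕ} (hq : 3 ≤ q) (hk : k < q) : 2 ≤ modulus q k := by
  have h1 := modulus_pos_aux hk
  have h2 : 3 ! ≤ q ! := Nat.factorial_le hq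
  have : q ! * 1 ≤ q ! * (q ! / (k + 1)) := Nat.mul_le_mul_left _ h1
  simp only [modulus, factorial] at *
  omega

/-- The modulus is one less than a multiple of `q !`, so no prime up to `q` divides it. -/
theorem lt_of_prime_dvd_modulus {k p : ℕ} (hk : k < q) (hp : p.Prime) (h : p ∣ modulus q k) :
    q < p := by
  by_contra! hle
  have h1 : p ∣ q ! * (q ! / (k + 1)) := ((hp.dvd_factorial).2 hle).mul_right _
  have h2 : 0 < q ! * (q ! / (k + 1)) := Nat.mul_pos (factorial_pos q) (modulus_pos_aux hk)
  have h3 := Nat.dvd_sub h1 h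
  rw [modulus, Nat.sub_sub_self h2] at h3
  exact hp.one_lt.ne' (Nat.dvd_one.1 h3)

theorem coprime_modulus_of_le {k l : ℕ} (hk : k < q) (hl : l ≤ q) :
    (modulus q k).Coprime (l !) := by
  refine Nat.coprime_of_dvd fun p hp h1 h2 => ?_
  have := lt_of_prime_dvd_modulus hk hp h1
  have := hp.dvd_factorial.1 h2
  omega

theorem le_sq_sub {k : ℕ} (hk : k < q) : k ≤ q ! ^ 2 - 1 := by
  have := Nat.self_le_factorial q
  have : q ! ≤ q ! ^ 2 := Nat.le_self_pow (by simp) _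
  omega

/-- The single number `q ! ^ 2 - 1` thus stands for every index `k` at once, each seen through its
own modulus. -/
theorem modEq_of_dvd_modulus {k m : ℕ} (hk : k < q) (h : m ∣ modulus q k) :
    q ! ^ 2 - 1 ≡ k [MOD m] := by
  refine ((Nat.modEq_iff_dvd' (le_sq_sub hk)).2 ?_).symm
  rw [← succ_mul_modulus hk]
  exact h.mul_left _

theorem coprime_modulus {k l : ℕ} (hk : k < q) (hl : l < q) (hkl : k ≠ l) :
    (modulus q k).Coprime (modulus q l) := by
  refine Nat.coprime_of_dvd fun p hp h1 h2 => ?_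
  have h := (modEq_of_dvd_modulus hk h1).symm.trans (modEq_of_dvd_modulus hl h2)
  have := lt_of_prime_dvd_modulus hk hp h1
  exact hkl (h.eq_of_lt_of_lt (by omega) (by omega))

theorem prod_modulus (hy : y ≤ q) :
    ∏ k ∈ Finset.range y, modulus q k = (q ! ^ 2 - 1).choose y := by
  have h1 := Nat.descFactorial_eq_factorial_mul_choose (q ! ^ 2 - 1) y
  rw [Nat.descFactorial_eq_prod_range] at h1
  have h2 : ∏ k ∈ Finset.range y, (q ! ^ 2 - 1 - k) = y ! * ∏ k ∈ Finset.range y, modulus q k := by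
    conv_rhs => rw [← Finset.prod_range_add_one_eq_factorial y]
    rw [← Finset.prod_mul_distrib]
    refine Finset.prod_congr rfl fun k hk => (succ_mul_modulus ?_).symm
    have := Finset.mem_range.1 hk
    omega
  exact Nat.eq_of_mul_eq_mul_left (factorial_pos y) (h2.symm.trans h1)

/-- The prime divides one of the factors `a - j` with `j ≤ u`. This lets a divisibility express a
bound on a residue. -/
theorem mod_le_of_dvd_choose {p a u : ℕ} (hp : p.Prime) (h : p ∣ a.choose (u + 1)) :
    a % p ≤ u := by
  have h1 : p ∣ a.descFactorial (u + 1) := by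
    rw [Nat.descFactorial_eq_factorial_mul_choose]; exact h.mul_left _
  rw [Nat.descFactorial_eq_prod_range, hp.prime.dvd_finsetProd_iff] at h1
  obtain ⟨j, hj, hpj⟩ := h1
  have hj := Finset.mem_range.1 hj
  rcases le_total j a with hja | hja
  · rw [← (Nat.modEq_iff_dvd' hja).2 hpj]
    exact (Nat.mod_le _ _).trans (by omega)
  · exact (Nat.mod_le _ _).trans (by omega)

theorem dvd_choose_of_modEq {m a z u : ℕ} (hm : m.Coprime ((u + 1)!)) (hz : z ≤ u)
    (h : a ≡ z [MOD m]) : m ∣ a.choose (u + 1) := by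
  refine hm.dvd_of_dvd_mul_left ?_
  rw [← Nat.descFactorial_eq_factorial_mul_choose, Nat.descFactorial_eq_prod_range]
  refine Dvd.dvd.trans ?_ (Finset.dvd_prod_of_mem _ (Finset.mem_range.2 (by omega : z < u + 1)))
  rcases le_total z a with hza | hza
  · exact (Nat.modEq_iff_dvd' hza).1 h.symm
  · simp [Nat.sub_eq_zero_of_le hza]

/-- Elimination of a bounded universal quantifier in front of a polynomial equation. -/
theorem forall_lt_exists_iff {n : ℕ} (P : ℕ → (Fin n → ℕ) → ℤ) (Q : ℕ → ℕ) (y : ℕ)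
    (hP : ∀ m k k' z z', k ≡ k' [MOD m] → (∀ i, z i ≡ z' i [MOD m]) → P k z ≡ P k' z' [ZMOD m])
    (hQ : ∀ u k z, k < y → (∀ i, z i ≤ u) → |P k z| ≤ Q u) :
    (∀ k < y, ∃ z, P k z = 0) ↔ ∃ (u c : ℕ) (a : Fin n → ℕ), c = (Q u + u + y + 3)! ^ 2 - 1 ∧
      (∀ i, c.choose y ∣ (a i).choose (u + 1)) ∧ c.choose y ∣ (P c a).natAbs := by
  constructor
  · intro h
    choose! z hz using h
    let u := (Finset.range y).sup fun k => Finset.univ.sup (z k)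
    have hu : ∀ k < y, ∀ i, z k i ≤ u := fun k hk i =>
      (Finset.le_sup (f := z k) (Finset.mem_univ i)).trans
        (Finset.le_sup (f := fun k => Finset.univ.sup (z k)) (Finset.mem_range.2 hk))
    -- The summands of `q` have separate roles: prime factors of the moduli exceed the values of
    -- `P`, the moduli are coprime to `(u + 1)!`, every `k < y` is below `q`, and `3` keeps the
    -- moduli at least `2`.
    obtain ⟨q, hq⟩ : ∃ q, q = Q u + u + y + 3 := ⟨_, rfl⟩
    have hlt : ∀ k ∈ Finset.range y, k < q := fun k hk => by
      have := Finset.mem_range.1 hk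
      omega
    have hcop : (Finset.range y : Set ℕ).Pairwise (Function.onFun Nat.Coprime (modulus q)) :=
      fun k hk l hl hkl => coprime_modulus (hlt k hk) (hlt l hl) hkl
    have hdvd : ∀ b : ℕ, (∀ k ∈ Finset.range y, modulus q k ∣ b) → (q ! ^ 2 - 1).choose y ∣ b := by
      intro b hb
      rw [← prod_modulus (by omega)]
      exact Finset.prod_dvd_of_isRelPrime
        (fun k hk l hl hkl => Nat.coprime_iff_isRelPrime.1 (hcop hk hl hkl)) hb
    have hcrt : ∀ i, ∃ a, ∀ k ∈ Finset.range y, a ≡ z k i [MOD modulus q k] := fun i =>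
      ⟨_, (Nat.chineseRemainderOfFinset (fun k => z k i) (modulus q) (Finset.range y)
        (fun k hk => by have := two_le_modulus (by omega) (hlt k hk); omega) hcop).2⟩
    choose a ha using hcrt
    refine ⟨u, q ! ^ 2 - 1, a, by rw [hq], fun i => hdvd _ fun k hk => ?_,
      hdvd _ fun k hk => ?_⟩
    · exact dvd_choose_of_modEq (coprime_modulus_of_le (hlt k hk) (by omega))
        (hu k (Finset.mem_range.1 hk) i) (ha i k hk)
    · have := hP (modulus q k) _ _ _ _ (modEq_of_dvd_modulus (hlt k hk) dvd_rfl)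
        (fun i => ha i k hk)
      rw [hz k (Finset.mem_range.1 hk)] at this
      exact Int.natCast_dvd.1 (Int.modEq_zero_iff_dvd.1 this)
  · rintro ⟨u, c, a, hc, ha, hPa⟩ k hk
    obtain ⟨q, hq⟩ : ∃ q, q = Q u + u + y + 3 := ⟨_, rfl⟩
    rw [← hq] at hc
    subst hc
    have hkq : k < q := by omega
    -- The witness for `k` is the residue of `a` modulo a prime factor `p` of the modulus of `k`.
    -- There `P` is divisible by `p` but smaller than `p` in absolute value, hence zero.
    have hp := Nat.minFac_prime (n := modulus q k)
      (by have := two_le_modulus (by omega) hkq; omega)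
    have hpd := Nat.minFac_dvd (modulus q k)
    generalize (modulus q k).minFac = p at hp hpd
    have hpN : p ∣ (q ! ^ 2 - 1).choose y := by
      rw [← prod_modulus (by omega)]
      exact hpd.trans (Finset.dvd_prod_of_mem _ (Finset.mem_range.2 hk))
    refine ⟨fun i => a i % p, ?_⟩
    have hqp := lt_of_prime_dvd_modulus hkq hp hpd
    have h1 := hQ u k (fun i => a i % p) hk
      (fun i => mod_le_of_dvd_choose hp (hpN.trans (ha i)))
    have h2 := hP p _ _ a (fun i => a i % p) (modEq_of_dvd_modulus hkq hpd)
      (fun i => (Nat.mod_modEq _ _).symm)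
    have h3 : (p : ℤ) ∣ P k (fun i => a i % p) :=
      (Int.ModEq.dvd_iff h2).1 (Int.natCast_dvd.2 (hpN.trans hPa))
    refine Int.eq_zero_of_abs_lt_dvd h3 (h1.trans_lt ?_)
    exact_mod_cast (by omega)

end BoundedQuantifier

/-! ### Bounds, congruences and finite support for integer polynomials. -/

namespace Poly

variable {α : Type*}

/-- Replace constants by absolute values and subtractions by additions. -/
theorem exists_majorant (p : Poly α) :
    ∃ q : Poly α, ∀ v w : α → ℕ, (∀ i, v i ≤ w i) → |p v| ≤ q w := by
  induction p using Poly.induction with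
  | H1 i => exact ⟨Poly.proj i, fun v w h => by simpa using h i⟩
  | H2 n => exact ⟨Poly.const |n|, fun v w h => by simp⟩
  | H3 f g hf hg =>
    obtain ⟨qf, hf⟩ := hf
    obtain ⟨qg, hg⟩ := hg
    exact ⟨qf + qg, fun v w h => (abs_sub _ _).trans (add_le_add (hf v w h) (hg v w h))⟩
  | H4 f g hf hg =>
    obtain ⟨qf, hf⟩ := hf
    obtain ⟨qg, hg⟩ := hg
    refine ⟨qf * qg, fun v w h => ?_⟩
    rw [Poly.mul_apply, abs_mul]
    exact mul_le_mul (hf v w h) (hg v w h) (abs_nonneg _) ((abs_nonneg _).trans (hf v w h))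

theorem modEq (p : Poly α) {m : ℕ} {v w : α → ℕ} (h : ∀ i, v i ≡ w i [MOD m]) :
    p v ≡ p w [ZMOD m] := by
  induction p using Poly.induction with
  | H1 i => exact Int.natCast_modEq_iff.2 (h i)
  | H2 n => rfl
  | H3 f g hf hg => exact hf.sub hg
  | H4 f g hf hg => exact hf.mul hg

theorem exists_finset_support {β : Type*} (p : Poly (α ⊕ β)) :
    ∃ s : Finset β, ∀ v (t t' : β → ℕ), (∀ i ∈ s, t i = t' i) →
      p (Sum.elim v t) = p (Sum.elim v t') := by
  classical
  induction p using Poly.induction with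
  | H1 i =>
    rcases i with i | i
    · exact ⟨∅, fun _ _ _ _ => rfl⟩
    · exact ⟨{i}, fun v t t' h => by simp [h i]⟩
  | H2 n => exact ⟨∅, fun _ _ _ _ => rfl⟩
  | H3 f g hf hg =>
    obtain ⟨s, hs⟩ := hf
    obtain ⟨s', hs'⟩ := hg
    refine ⟨s ∪ s', fun v t t' h => ?_⟩
    rw [Poly.sub_apply, Poly.sub_apply, hs v t t' fun i hi => h i (Finset.mem_union_left _ hi),
      hs' v t t' fun i hi => h i (Finset.mem_union_right _ hi)]
  | H4 f g hf hg =>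
    obtain ⟨s, hs⟩ := hf
    obtain ⟨s', hs'⟩ := hg
    refine ⟨s ∪ s', fun v t t' h => ?_⟩
    rw [Poly.mul_apply, Poly.mul_apply, hs v t t' fun i hi => h i (Finset.mem_union_left _ hi),
      hs' v t t' fun i hi => h i (Finset.mem_union_right _ hi)]

end Poly

/-! ### Closure properties of Diophantine sets. -/

namespace Dioph

variable {α : Type}

/-- Finitely many dummy variables suffice. -/
theorem exists_fin {S : Set (α → ℕ)} (h : Dioph S) :
    ∃ (n : ℕ) (p : Poly (α ⊕ Fin n)), ∀ v, v ∈ S ↔ ∃ t, p (Sum.elim v t) = 0 := by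
  classical
  obtain ⟨β, p, hp⟩ := h
  obtain ⟨s, hs⟩ := p.exists_finset_support
  -- All variables outside the support share the one extra index, which keeps `g` total even when
  -- the support is empty.
  let g : β → Fin (s.card + 1) := fun b => if h : b ∈ s then (s.equivFin ⟨b, h⟩).castSucc else
    Fin.last _
  refine ⟨s.card + 1, p.map (Sum.map id g), fun v => (hp v).trans ⟨?_, ?_⟩⟩
  · rintro ⟨t, ht⟩
    refine ⟨Fin.snoc (α := fun _ => ℕ) (fun i => t (s.equivFin.symm i)) 0, ?_⟩
    rw [Poly.map_apply, Sum.elim_comp_map, Function.comp_id, ← ht]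
    refine hs _ _ _ fun i hi => ?_
    simp [g, hi]
  · rintro ⟨t, ht⟩
    refine ⟨t ∘ g, ?_⟩
    rwa [Poly.map_apply, Sum.elim_comp_map, Function.comp_id] at ht

theorem exists_dioph {R : (α → ℕ) → ℕ → Prop}
    (h : Dioph {w : Option α → ℕ | R (w ∘ some) (w none)}) : Dioph {v | ∃ m, R v m} :=
  ex1_dioph h

theorem subst_dioph {R : (α → ℕ) → ℕ → Prop}
    (h : Dioph {w : Option α → ℕ | R (w ∘ some) (w none)}) {f : (α → ℕ) → ℕ} (hf : DiophFn f) :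
    Dioph {v | R v (f v)} :=
  diophFn_comp1 h hf

theorem lift_diophFn {f : (α → ℕ) → ℕ} (hf : DiophFn f) :
    DiophFn fun w : Option α → ℕ => f (w ∘ some) :=
  reindex_diophFn some hf

theorem diophFn_of_graph {f : (α → ℕ) → ℕ}
    (h : Dioph {w : Option α → ℕ | w none = f (w ∘ some)}) : DiophFn f :=
  ext h fun _ => eq_comm

theorem natConst_dioph (n : ℕ) : DiophFn fun _ : α → ℕ => n := const_dioph n

theorem forall_fin_dioph {n : ℕ} {S : Fin n → Set (α → ℕ)} (h : ∀ i, Dioph (S i)) :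
    Dioph {v | ∀ i, v ∈ S i} :=
  ext (DiophList.forall (List.ofFn S) (List.forall_iff_forall_mem.2 fun T hT => by
    obtain ⟨i, rfl⟩ := (List.mem_ofFn' _ _).1 hT
    exact h i)) fun v => by
    simp [List.forall_iff_forall_mem, List.mem_ofFn']

variable {f g : (α → ℕ) → ℕ} (hf : DiophFn f) (hg : DiophFn g)

include hf in
theorem two_pow_succ_dioph : DiophFn fun v => 2 ^ (f v + 1) :=
  pow_dioph (natConst_dioph 2) (add_dioph hf (natConst_dioph 1))

include hf hg in
theorem choose_dioph : DiophFn fun v => (f v).choose (g v) := by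
  simp only [Nat.choose_eq_div_mod]
  have h := two_pow_succ_dioph hf
  exact mod_dioph (div_dioph (pow_dioph (add_dioph h (natConst_dioph 1)) hf) (pow_dioph h hg)) h

include hf in
theorem factorial_dioph : DiophFn fun v => (f v).factorial := by
  have h1 := add_dioph hf (natConst_dioph 1)
  have h := mul_dioph (pow_dioph h1 (natConst_dioph 2))
    (add_dioph (pow_dioph h1 hf) (natConst_dioph 1))
  have := div_dioph (pow_dioph h hf) (choose_dioph h hf)
  simpa only [← Nat.factorial_eq_pow_div_choose'] using this

/-- Diophantine predicates are closed under bounded universal quantification. -/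
theorem forall_lt_dioph {R : (α → ℕ) → ℕ → Prop}
    (h : Dioph {w : Option α → ℕ | R (w ∘ some) (w none)}) (hf : DiophFn f) :
    Dioph {v | ∀ k < f v, R v k} := by
  refine subst_dioph (R := fun v y => ∀ k < y, R v k) ?_ hf
  obtain ⟨n, p, hp⟩ := h.exists_fin
  obtain ⟨q, hq⟩ := p.exists_majorant
  -- The auxiliary variables are `u` at `.inr false`, `c` at `.inr true` and `a i` at `.inl i`. In
  -- the majorant `q`, the bound `w none` stands in the place of `k`.
  have key : ∀ w : Option α → ℕ, (∀ k < w none, R (w ∘ some) k) ↔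
      ∃ b : Fin n ⊕ Bool → ℕ, b (.inr true) = ((q (Sum.elim w fun _ => b (.inr false))).natAbs +
          b (.inr false) + w none + 3).factorial ^ 2 - 1 ∧
        (∀ i, (b (.inr true)).choose (w none) ∣ (b (.inl i)).choose (b (.inr false) + 1)) ∧
        (b (.inr true)).choose (w none) ∣
          (p (Sum.elim (Option.elim' (b (.inr true)) (w ∘ some)) (b ∘ .inl))).natAbs := by
    intro w
    have h1 : ∀ k, R (w ∘ some) k ↔ ∃ z, p (Sum.elim (Option.elim' k (w ∘ some)) z) = 0 :=
      fun k => hp (Option.elim' k (w ∘ some))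
    simp only [h1]
    rw [BoundedQuantifier.forall_lt_exists_iff
      (fun k z => p (Sum.elim (Option.elim' k (w ∘ some)) z))
      (fun u => (q (Sum.elim w fun _ => u)).natAbs)]
    · constructor
      · rintro ⟨u, c, a, h1, h2, h3⟩
        exact ⟨Sum.elim a fun b => bif b then c else u, h1, h2, h3⟩
      · rintro ⟨b, h1, h2, h3⟩
        exact ⟨b (.inr false), b (.inr true), b ∘ .inl, h1, h2, h3⟩
    · intro m k k' z z' hk hz
      refine p.modEq ?_
      rintro ((_ | i) | i)
      · exact hk
      · rfl
      · exact hz i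
    · intro u k z hk hz
      rw [Int.natCast_natAbs]
      refine (hq _ _ ?_).trans (le_abs_self _)
      rintro ((_ | i) | i)
      · exact hk.le
      · exact le_rfl
      · exact hz i
  refine ext (ex_dioph (β := Fin n ⊕ Bool) (S := {x : Option α ⊕ (Fin n ⊕ Bool) → ℕ |
    x (.inr (.inr true)) = ((q (Sum.elim (x ∘ .inl) fun _ => x (.inr (.inr false)))).natAbs +
          x (.inr (.inr false)) + x (.inl none) + 3).factorial ^ 2 - 1 ∧
        (∀ i, (x (.inr (.inr true))).choose (x (.inl none)) ∣
          (x (.inr (.inl i))).choose (x (.inr (.inr false)) + 1)) ∧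
        (x (.inr (.inr true))).choose (x (.inl none)) ∣
          (p (Sum.elim (Option.elim' (x (.inr (.inr true))) (x ∘ .inl ∘ some))
            (x ∘ .inr ∘ .inl))).natAbs}) ?_) fun w => (key w).symm
  have hN : DiophFn fun x : Option α ⊕ (Fin n ⊕ Bool) → ℕ =>
      (x (.inr (.inr true))).choose (x (.inl none)) :=
    choose_dioph (proj_dioph _) (proj_dioph _)
  refine inter (S := {x | _}) (S' := {x | _}) ?_ (inter (S := {x | _}) (S' := {x | _}) ?_ ?_)
  · refine eq_dioph (proj_dioph _) (sub_dioph (pow_dioph (factorial_dioph (add_dioph (add_dioph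
      (add_dioph ?_ (proj_dioph _)) (proj_dioph _)) (natConst_dioph 3))) (natConst_dioph 2))
      (natConst_dioph 1))
    convert abs_poly_dioph (q.map (Sum.elim Sum.inl fun _ => Sum.inr (Sum.inr false))) with x
    rw [Poly.map_apply]
    congr 1
    ext (i | i) <;> rfl
  · exact forall_fin_dioph fun i => dvd_dioph hN
      (choose_dioph (proj_dioph _) (add_dioph (proj_dioph _) (natConst_dioph 1)))
  · refine dvd_dioph hN ?_
    convert abs_poly_dioph (p.map (Sum.elim (Option.elim' (Sum.inr (Sum.inr true))
      (Sum.inl ∘ some)) (Sum.inr ∘ Sum.inl))) with x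
    rw [Poly.map_apply]
    congr 1
    ext ((_ | i) | i) <;> rfl

end Dioph

/-! ### Partial recursive functions are Diophantine. -/

namespace Dioph

variable {α : Type} {f g : (α → ℕ) → ℕ}

theorem and_dioph {P Q : (α → ℕ) → Prop} (hP : Dioph {v | P v}) (hQ : Dioph {v | Q v}) :
    Dioph {v | P v ∧ Q v} := inter hP hQ

theorem or_dioph {P Q : (α → ℕ) → Prop} (hP : Dioph {v | P v}) (hQ : Dioph {v | Q v}) :
    Dioph {v | P v ∨ Q v} := union hP hQ

theorem pair_dioph (hf : DiophFn f) (hg : DiophFn g) : DiophFn fun v => Nat.pair (f v) (g v) := by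
  refine diophFn_of_graph ?_
  have hf := lift_diophFn hf
  have hg := lift_diophFn hg
  refine ext (or_dioph (and_dioph (lt_dioph hf hg)
      (eq_dioph (proj_dioph none) (add_dioph (mul_dioph hg hg) hf)))
    (and_dioph (le_dioph hg hf)
      (eq_dioph (proj_dioph none) (add_dioph (add_dioph (mul_dioph hf hf) hf) hg)))) fun w => ?_
  simp only [Set.mem_ofPred_eq, Nat.pair]
  split_ifs with h <;> simp [h]
  omega

theorem unpair_fst_dioph (hf : DiophFn f) : DiophFn fun v => (f v).unpair.1 := by
  refine diophFn_of_graph (ext (exists_dioph (R := fun w b => Nat.pair (w none) b = f (w ∘ some))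
    (eq_dioph (pair_dioph (proj_dioph (some none)) (proj_dioph none))
      (lift_diophFn (lift_diophFn hf)))) fun w => ⟨?_, fun h => ?_⟩)
  · rintro ⟨b, hb⟩
    simp [← hb]
  · exact ⟨(f (w ∘ some)).unpair.2, by have h : w none = _ := h; simp [h]⟩

theorem unpair_snd_dioph (hf : DiophFn f) : DiophFn fun v => (f v).unpair.2 := by
  refine diophFn_of_graph (ext (exists_dioph (R := fun w b => Nat.pair b (w none) = f (w ∘ some))
    (eq_dioph (pair_dioph (proj_dioph none) (proj_dioph (some none)))
      (lift_diophFn (lift_diophFn hf)))) fun w => ⟨?_, fun h => ?_⟩)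
  · rintro ⟨b, hb⟩
    simp [← hb]
  · exact ⟨(f (w ∘ some)).unpair.1, by have h : w none = _ := h; simp [h]⟩

theorem beta_dioph (hf : DiophFn f) (hg : DiophFn g) : DiophFn fun v => Nat.beta (f v) (g v) :=
  mod_dioph (unpair_fst_dioph hf) (add_dioph
    (mul_dioph (add_dioph hg (natConst_dioph 1)) (unpair_snd_dioph hf)) (natConst_dioph 1))

/-- The graph of a partial function, with Diophantine terms for argument and value, is
Diophantine. -/
def DiophGraph (φ : ℕ →. ℕ) : Prop :=
  ∀ {α : Type} {f g : (α → ℕ) → ℕ}, DiophFn f → DiophFn g → Dioph {v | g v ∈ φ (f v)}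

theorem diophGraph_of_diophFn {φ : ℕ → ℕ}
    (h : ∀ {α : Type} {f : (α → ℕ) → ℕ}, DiophFn f → DiophFn fun v => φ (f v)) :
    DiophGraph φ := fun hf hg =>
  ext (eq_dioph hg (h hf)) fun v => by simp

theorem mem_prec_iff (φ ψ : ℕ →. ℕ) (a n b : ℕ) :
    b ∈ (Nat.rec (φ a) (fun y IH => IH.bind fun i => ψ (Nat.pair a (Nat.pair y i))) n : Part ℕ) ↔
      ∃ s : ℕ → ℕ, s 0 ∈ φ a ∧ (∀ i < n, s (i + 1) ∈ ψ (Nat.pair a (Nat.pair i (s i)))) ∧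
        s n = b := by
  induction n generalizing b with
  | zero => exact ⟨fun h => ⟨fun _ => b, h, by simp, rfl⟩, fun ⟨s, h, _, e⟩ => e ▸ h⟩
  | succ n ih =>
    simp only [Part.mem_bind_iff, ih]
    constructor
    · rintro ⟨c, ⟨s, h0, hs, rfl⟩, hb⟩
      refine ⟨fun i => if i ≤ n then s i else b, by simpa using h0, fun i hi => ?_, by simp⟩
      rcases Nat.lt_succ_iff_lt_or_eq.1 hi with h | rfl
      · simpa [h.le, Nat.succ_le_of_lt h] using hs i h
      · simpa using hb
    · rintro ⟨s, h0, hs, rfl⟩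
      exact ⟨s n, ⟨s, h0, fun i hi => hs i (by omega), rfl⟩, hs n (by omega)⟩

theorem exists_beta_eq (s : ℕ → ℕ) (n : ℕ) : ∃ c, ∀ i ≤ n, Nat.beta c i = s i := by
  refine ⟨Nat.unbeta ((List.range (n + 1)).map s), fun i hi => ?_⟩
  have h := Nat.beta_unbeta_coe ((List.range (n + 1)).map s)
    ⟨i, by simpa using Nat.lt_succ_of_le hi⟩
  simpa using h

/-- Gödel's beta function packs the history of the recursion into one number, so that only a bounded
quantifier over the steps remains. -/
theorem mem_prec_iff_beta (φ ψ : ℕ →. ℕ) (a n b : ℕ) :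
    b ∈ (Nat.rec (φ a) (fun y IH => IH.bind fun i => ψ (Nat.pair a (Nat.pair y i))) n : Part ℕ) ↔
      ∃ c, Nat.beta c 0 ∈ φ a ∧
        (∀ i < n, Nat.beta c (i + 1) ∈ ψ (Nat.pair a (Nat.pair i (Nat.beta c i)))) ∧
        Nat.beta c n = b := by
  rw [mem_prec_iff]
  constructor
  · rintro ⟨s, h0, hs, hb⟩
    obtain ⟨c, hc⟩ := exists_beta_eq s n
    refine ⟨c, by rwa [hc 0 (Nat.zero_le _)], fun i hi => ?_, by rwa [hc n le_rfl]⟩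
    rw [hc i hi.le, hc (i + 1) hi]
    exact hs i hi
  · rintro ⟨c, h0, hs, hb⟩
    exact ⟨Nat.beta c, h0, hs, hb⟩

/-- The **MRDP theorem**: graphs of partial recursive functions are Diophantine. -/
theorem diophGraph_of_partrec {φ : ℕ →. ℕ} (h : Nat.Partrec φ) : DiophGraph φ := by
  induction h with
  | zero => exact diophGraph_of_diophFn (φ := fun _ => 0) fun _ => natConst_dioph 0
  | succ => exact diophGraph_of_diophFn fun hf => add_dioph hf (natConst_dioph 1)
  | left => exact diophGraph_of_diophFn unpair_fst_dioph
  | right => exact diophGraph_of_diophFn unpair_snd_dioph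
  | @pair φ ψ _ _ ihφ ihψ =>
    intro α f g hf hg
    refine ext (and_dioph (ihφ hf (unpair_fst_dioph hg)) (ihψ hf (unpair_snd_dioph hg)))
      fun v => ?_
    simp only [Set.mem_ofPred_eq, Seq.seq, Part.map_eq_map, Part.mem_bind_iff,
      Part.mem_map_iff]
    constructor
    · rintro ⟨h1, h2⟩
      exact ⟨_, ⟨_, h1, rfl⟩, _, h2, Nat.pair_unpair _⟩
    · rintro ⟨_, ⟨a, ha, rfl⟩, b, hb, h⟩
      rw [← h]
      simpa using ⟨ha, hb⟩
  | @comp φ ψ _ _ ihφ ihψ =>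
    intro α f g hf hg
    refine ext (exists_dioph (R := fun v m => m ∈ ψ (f v) ∧ g v ∈ φ m)
      (and_dioph (ihψ (lift_diophFn hf) (proj_dioph none))
        (ihφ (proj_dioph none) (lift_diophFn hg)))) fun v => ?_
    exact Part.mem_bind_iff.symm
  | @prec φ ψ _ _ ihφ ihψ =>
    intro α f g hf hg
    have ha := unpair_fst_dioph hf
    have hn := unpair_snd_dioph hf
    refine ext (exists_dioph (R := fun v c => Nat.beta c 0 ∈ φ (f v).unpair.1 ∧
      (∀ i < (f v).unpair.2, Nat.beta c (i + 1) ∈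
        ψ (Nat.pair (f v).unpair.1 (Nat.pair i (Nat.beta c i)))) ∧
      Nat.beta c (f v).unpair.2 = g v) ?_) fun v => (mem_prec_iff_beta φ ψ _ _ _).symm
    refine and_dioph (ihφ (lift_diophFn ha) (beta_dioph (proj_dioph none) (natConst_dioph 0)))
      (and_dioph ?_ (eq_dioph (beta_dioph (proj_dioph none) (lift_diophFn hn)) (lift_diophFn hg)))
    refine forall_lt_dioph (R := fun w i => Nat.beta (w none) (i + 1) ∈
        ψ (Nat.pair (f (w ∘ some)).unpair.1 (Nat.pair i (Nat.beta (w none) i))))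
      ?_ (lift_diophFn hn)
    exact ihψ (pair_dioph (lift_diophFn (lift_diophFn ha)) (pair_dioph (proj_dioph none)
        (beta_dioph (proj_dioph (some none)) (proj_dioph none))))
      (beta_dioph (proj_dioph (some none)) (add_dioph (proj_dioph none) (natConst_dioph 1)))
  | @rfind φ _ ihφ =>
    intro α f g hf hg
    -- The search succeeds at value `0`; all earlier values must be defined and nonzero, which is
    -- again a bounded quantifier.
    refine ext (and_dioph (ihφ (pair_dioph hf hg) (natConst_dioph 0))
      (forall_lt_dioph (R := fun v m => ∃ y, y ∈ φ (Nat.pair (f v) m) ∧ y ≠ 0)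
        (exists_dioph (R := fun w y => y ∈ φ (Nat.pair (f (w ∘ some)) (w none)) ∧ y ≠ 0)
          (and_dioph (ihφ (pair_dioph (lift_diophFn (lift_diophFn hf)) (proj_dioph (some none)))
            (proj_dioph none)) (ne_dioph (proj_dioph none) (natConst_dioph 0)))) hg)) fun v => ?_
    refine Iff.trans ?_ Nat.mem_rfind.symm
    simp [Part.mem_map_iff]

/-- The domain of a partial recursive function is the projection of the zero set of a polynomial. -/
theorem exists_poly_of_partrec {φ : ℕ →. ℕ} (h : Nat.Partrec φ) :
    ∃ (n : ℕ) (p : Poly (Unit ⊕ Fin n)), ∀ a, (φ a).Dom ↔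
      ∃ t, p (Sum.elim (fun _ => a) t) = 0 := by
  have h1 : Dioph {v : Unit → ℕ | ∃ y, y ∈ φ (v ())} :=
    exists_dioph (R := fun v y => y ∈ φ (v ()))
      (diophGraph_of_partrec h (proj_dioph (some ())) (proj_dioph none))
  obtain ⟨n, p, hp⟩ := h1.exists_fin
  exact ⟨n, p, fun a => Part.dom_iff_mem.trans (hp fun _ => a)⟩

end Dioph

/-! ### From Diophantine sets to polynomials evaluated at real points. -/

theorem Poly.exists_mvPolynomial {α : Type*} (p : Poly α) :
    ∃ P : MvPolynomial α ℤ, ∀ v : α → ℕ, p v = MvPolynomial.eval (fun i => (v i : ℤ)) P := by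
  induction p using Poly.induction with
  | H1 i => exact ⟨MvPolynomial.X i, fun v => by simp⟩
  | H2 n => exact ⟨MvPolynomial.C n, fun v => by simp⟩
  | H3 f g hf hg =>
    obtain ⟨P, hP⟩ := hf
    obtain ⟨Q, hQ⟩ := hg
    exact ⟨P - Q, fun v => by simp [hP, hQ]⟩
  | H4 f g hf hg =>
    obtain ⟨P, hP⟩ := hf
    obtain ⟨Q, hQ⟩ := hg
    exact ⟨P * Q, fun v => by simp [hP, hQ]⟩

/-- The domain of a partial recursive function is the set of parameters for which an integer
polynomial equation is solvable in natural numbers. -/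
theorem exists_mvPolynomial_of_partrec {φ : ℕ →. ℕ} (h : Nat.Partrec φ) :
    ∃ (n : ℕ) (P : MvPolynomial (Unit ⊕ Fin n) ℤ), ∀ a, (φ a).Dom ↔ ∃ t : Fin n → ℕ,
      MvPolynomial.aeval (Sum.elim (fun _ => (a : ℝ)) (fun i => (t i : ℝ))) P = 0 := by
  obtain ⟨n, p, hp⟩ := Dioph.exists_poly_of_partrec h
  obtain ⟨P, hP⟩ := p.exists_mvPolynomial
  refine ⟨n, P, fun a => (hp a).trans (exists_congr fun t => ?_)⟩
  have e : (Sum.elim (fun _ => (a : ℝ)) (fun i => (t i : ℝ)) : Unit ⊕ Fin n → ℝ) =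
      fun i => algebraMap ℤ ℝ ((Sum.elim (fun _ => a) t i : ℕ) : ℤ) := by
    ext (i | i) <;> simp
  have h := MvPolynomial.aeval_algebraMap_apply ℝ
    (fun i => ((Sum.elim (fun _ => a) t i : ℕ) : ℤ)) P
  rw [hP, e]
  refine Iff.trans ?_ (Eq.congr_left h).symm
  simp [MvPolynomial.aeval_eq_eval]

/-! ### Codes of polynomials, and the reduction. -/

namespace OrbitHits

theorem exists_ratVal_eq (q : ℚ) : ∃ c : RatCode, ratVal c = q := by
  refine ⟨(q.num, q.den - 1), ?_⟩
  have h : ((q.den - 1 : ℕ) : ℚ) + 1 = q.den := by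
    rw [Nat.cast_sub q.pos]
    simp
  simp only [ratVal, h, Rat.num_div_den]

theorem exists_polyCode {d : ℕ} (P : MvPolynomial (Fin d) ℚ) :
    ∃ p : PolyCode, (∀ m ∈ p, m.2.length = d) ∧
      ∀ x : Fin d → ℝ, polyEval p x = MvPolynomial.aeval x P := by
  induction P using MvPolynomial.induction_on' with
  | monomial u a =>
    obtain ⟨c, hc⟩ := exists_ratVal_eq a
    refine ⟨[(c, List.ofFn u)], by simp, fun x => ?_⟩
    simp [polyEval, monomialEval, hc, MvPolynomial.aeval_monomial, Finsupp.prod_fintype]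
  | add P Q hP hQ =>
    obtain ⟨p, hp, hp'⟩ := hP
    obtain ⟨q, hq, hq'⟩ := hQ
    refine ⟨p ++ q, fun m hm => ?_, fun x => ?_⟩
    · rcases List.mem_append.1 hm with h | h
      exacts [hp m h, hq m h]
    · rw [map_add, ← hp', ← hq']
      simp [polyEval]

/-- A code of a polynomial. -/
noncomputable def polyCode {d : ℕ} (P : MvPolynomial (Fin d) ℚ) : PolyCode :=
  (exists_polyCode P).choose

theorem length_of_mem_polyCode {d : ℕ} {P : MvPolynomial (Fin d) ℚ} {m : MonomialCode}
    (h : m ∈ polyCode P) : m.2.length = d :=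
  (exists_polyCode P).choose_spec.1 m h

@[simp]
theorem polyEval_polyCode {d : ℕ} (P : MvPolynomial (Fin d) ℚ) (x : Fin d → ℝ) :
    polyEval (polyCode P) x = MvPolynomial.aeval x P :=
  (exists_polyCode P).choose_spec.2 x

namespace Reduction

/-! ### The reduction

The coordinates are indexed by the sets `T` of indices in `{0, …, n}`. At time `t` the coordinate
of index `T` is `∏ i ∈ T, (t - y i)`, for an increasing sequence `y` with `y 0 = a + 1`. -/

open MvPolynomial

variable (n : ℕ)

/-- The dimension of the ambient space. -/
def dim : ℕ := Fintype.card (Finset (Fin (n + 1)))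

/-- The coordinate with a given index. -/
noncomputable def coord : Finset (Fin (n + 1)) ≃ Fin (dim n) := Fintype.equivFin _

/-- The coordinate that is `-y i` at the initial point. -/
noncomputable abbrev root (i : Fin (n + 1)) : MvPolynomial (Fin (dim n)) ℚ := X (coord n {i})

/-- The equations for the initial points that do not depend on the parameter. -/
noncomputable def equations (P : MvPolynomial (Unit ⊕ Fin n) ℤ) :
    List (MvPolynomial (Fin (dim n)) ℚ) :=
  aeval (Sum.elim (fun _ => -root n 0 - 1)
      (fun i => root n i.castSucc - root n i.succ - 1)) P ::
    Finset.univ.toList.map fun T => X (coord n T) - ∏ i ∈ T, root n i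

/-- The inequalities for the initial points. -/
noncomputable def inequalities : List (MvPolynomial (Fin (dim n)) ℚ) :=
  List.ofFn fun i : Fin n => root n i.castSucc - root n i.succ

/-- The code of the equation `1 - y 0 / (a + 1) = 0`. -/
noncomputable def parameterCode (a : ℕ) : PolyCode :=
  [((1, a), List.ofFn fun j => if j = coord n {0} then 1 else 0),
    ((1, 0), List.ofFn fun _ : Fin (dim n) => 0)]

/-- The input that corresponds to a parameter of a Diophantine equation. -/
noncomputable abbrev input (P : MvPolynomial (Unit ⊕ Fin n) ℤ) (a : ℕ) : Input where
  k := n + 1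
  dim := dim n
  initial := [(parameterCode n a :: (equations n P).map polyCode,
    (inequalities n).map polyCode)]
  rows := List.ofFn fun i => List.ofFn fun j =>
    if (coord n).symm j ⊆ (coord n).symm i then (1, 0) else (0, 0)
  normal := List.ofFn fun j => if j = coord n Finset.univ then (1, 0) else (0, 0)
  offset := (0, 0)

/-- The parameter enters only as the denominator part of the rational code `(1, a)`. Everything else
is constant, so the choice made in `polyCode` does no harm. -/
theorem computable_input (P : MvPolynomial (Unit ⊕ Fin n) ℤ) : Computable (input n P) := by
  have h1 : Primrec (parameterCode n) :=
    Primrec.list_cons.comp (Primrec.pair (Primrec.pair (Primrec.const 1) Primrec.id)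
      (Primrec.const _)) (Primrec.const _)
  have h2 : Primrec fun a => (input n P a).initial :=
    Primrec.list_cons.comp (Primrec.pair (Primrec.list_cons.comp h1 (Primrec.const _))
      (Primrec.const _)) (Primrec.const [])
  have h3 : Primrec fun a => Input.equivProd (input n P a) :=
    Primrec.pair (Primrec.const _) (Primrec.pair (Primrec.const _) (Primrec.pair h2
      (Primrec.const ((input n P 0).rows, (input n P 0).normal, (input n P 0).offset))))
  exact ((Primrec.of_equiv_symm (e := Input.equivProd)).comp h3).to_comp

@[simp] theorem ratVal_zero : ratVal (0, 0) = 0 := by simp [ratVal]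

@[simp] theorem ratVal_one : ratVal (1, 0) = 1 := by simp [ratVal]

variable {n} (P : MvPolynomial (Unit ⊕ Fin n) ℤ) (a : ℕ)

theorem matrix_input (S T : Finset (Fin (n + 1))) :
    (input n P a).matrix (coord n T) (coord n S) = if S ⊆ T then 1 else 0 := by
  have h : (input n P a).matrix (coord n T) (coord n S) =
      ratVal (if (coord n).symm (coord n S) ⊆ (coord n).symm (coord n T) then (1, 0)
        else (0, 0)) := by
    simp [Input.matrix, input]
  rw [h, Equiv.symm_apply_apply, Equiv.symm_apply_apply]
  split_ifs <;> simp

theorem normalVec_input (j : Fin (dim n)) :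
    (input n P a).normalVec j = if j = coord n Finset.univ then 1 else 0 := by
  have h : (input n P a).normalVec j =
      ratVal (if j = coord n Finset.univ then (1, 0) else (0, 0)) := by
    simp [Input.normalVec, input]
  rw [h]
  split_ifs <;> simp

theorem mem_hyperplane_input (z : Fin (dim n) → ℝ) :
    z ∈ (input n P a).hyperplane ↔ z (coord n Finset.univ) = 0 := by
  have h : (fun i => ((input n P a).normalVec i : ℝ)) ⬝ᵥ z = z (coord n Finset.univ) := by
    refine (Finset.sum_congr rfl fun j _ => ?_).trans
      (Fintype.sum_ite_eq' (coord n Finset.univ) z)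
    change ((input n P a).normalVec j : ℝ) * z j = _
    rw [normalVec_input P a j]
    split_ifs <;> simp
  have h0 : ratVal (input n P a).offset = 0 := ratVal_zero
  rw [← h]
  simp [Input.hyperplane, h0]

theorem wellFormed_input : (input n P a).WellFormed where
  initial_wf := by
    intro s hs p hp m hm
    obtain rfl : s = _ := List.mem_singleton.1 hs
    simp only [List.cons_append, List.mem_cons, List.mem_append, List.mem_map] at hp
    rcases hp with rfl | ⟨Q, -, rfl⟩ | ⟨Q, -, rfl⟩
    · simp only [parameterCode, List.mem_cons, List.not_mem_nil, or_false] at hm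
      rcases hm with rfl | rfl <;> exact List.length_ofFn
    · exact length_of_mem_polyCode hm
    · exact length_of_mem_polyCode hm
  rows_length := List.length_ofFn
  row_length := by
    intro r hr
    obtain ⟨i, rfl⟩ := (List.mem_ofFn' _ _).1 hr
    exact List.length_ofFn
  normal_length := List.length_ofFn
  normal_ne_zero := fun h => by
    have := congrFun h (coord n Finset.univ)
    rw [normalVec_input, if_pos rfl] at this
    exact one_ne_zero this

theorem homogeneous_input : (input n P a).Homogeneous := ratVal_zero

theorem polyEval_parameterCode (x : Fin (dim n) → ℝ) :
    polyEval (parameterCode n a) x = 0 ↔ x (coord n {0}) = -(a + 1) := by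
  have h : polyEval (parameterCode n a) x = x (coord n {0}) / (a + 1) + 1 := by
    simp [polyEval, parameterCode, monomialEval, ratVal, pow_ite, Finset.prod_ite_eq']
    ring
  have : (a : ℝ) + 1 ≠ 0 := by positivity
  rw [h]
  rw [← eq_neg_iff_add_eq_zero, div_eq_iff this, neg_one_mul]

theorem mem_initialSet_input (x : Fin (dim n) → ℝ) :
    x ∈ (input n P a).initialSet ↔
      x (coord n {0}) = -(a + 1) ∧
      aeval (Sum.elim (fun _ => -x (coord n {0}) - 1) (fun i : Fin n =>
        x (coord n {i.castSucc}) - x (coord n {i.succ}) - 1)) P = 0 ∧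
      (∀ T, x (coord n T) = ∏ i ∈ T, x (coord n {i})) ∧
      ∀ i : Fin n, x (coord n {i.succ}) < x (coord n {i.castSucc}) := by
  have h : x ∈ (input n P a).initialSet ↔
      (∀ p ∈ parameterCode n a :: (equations n P).map polyCode, polyEval p x = 0) ∧
      (∀ q ∈ (inequalities n).map polyCode, 0 < polyEval q x) :=
    ⟨fun ⟨s, hs, h⟩ => by rwa [List.mem_singleton.1 hs] at h,
      fun h => ⟨_, List.mem_singleton_self _, h⟩⟩
  have h2 : aeval x (aeval (Sum.elim (fun _ => -root n 0 - 1)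
      (fun i => root n i.castSucc - root n i.succ - 1)) P) =
      aeval (Sum.elim (fun _ => -x (coord n {0}) - 1) (fun i : Fin n =>
        x (coord n {i.castSucc}) - x (coord n {i.succ}) - 1)) P := by
    rw [← AlgHom.coe_restrictScalars' ℤ (aeval x), ← AlgHom.comp_apply, comp_aeval]
    congr 2
    ext (i | i) <;> simp
  rw [h, List.forall_mem_cons, polyEval_parameterCode, equations, List.map_cons,
    List.forall_mem_cons, polyEval_polyCode, h2]
  simp [inequalities, sub_eq_zero, and_assoc]

theorem orbit_input {x : Fin (dim n) → ℝ}
    (hx : ∀ T, x (coord n T) = ∏ i ∈ T, x (coord n {i})) (t : ℕ) (T : Finset (Fin (n + 1))) :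
    (input n P a).orbit x t (coord n T) = ∏ i ∈ T, (t + x (coord n {i})) := by
  induction t generalizing T with
  | zero =>
    have : (input n P a).orbit x 0 = x := by
      simp only [Input.orbit, pow_zero]
      exact Matrix.one_mulVec x
    rw [this, hx]
    simp
  | succ t ih =>
    have h : (input n P a).orbit x (t + 1) =
        ((input n P a).matrix.map fun q : ℚ => (q : ℝ)).mulVec ((input n P a).orbit x t) := by
      rw [Input.orbit, Input.orbit, pow_succ', Matrix.mulVec_mulVec]
    have h2 : (input n P a).orbit x (t + 1) (coord n T) = ∑ S,
        ((input n P a).matrix (coord n T) (coord n S) : ℝ) *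
          (input n P a).orbit x t (coord n S) := by
      rw [h]
      exact (Equiv.sum_comp (coord n) fun j =>
        ((input n P a).matrix (coord n T) j : ℝ) * (input n P a).orbit x t j).symm
    rw [h2]
    simp only [ih, matrix_input]
    push_cast
    -- Expanding `∏ i ∈ T, (z i + 1)` over subsets yields the row of the matrix with index `T`.
    simp only [add_right_comm _ (1 : ℝ), Finset.prod_add_one]
    simp only [apply_ite (Rat.cast : ℚ → ℝ), Rat.cast_one, Rat.cast_zero, ite_mul, one_mul,
      zero_mul, ← Finset.mem_powerset, Finset.sum_ite_mem, Finset.univ_inter]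

theorem orbit_input_mem_hyperplane {x : Fin (dim n) → ℝ}
    (hx : ∀ T, x (coord n T) = ∏ i ∈ T, x (coord n {i})) (t : ℕ) :
    (input n P a).orbit x t ∈ (input n P a).hyperplane ↔ ∃ i, x (coord n {i}) = -(t : ℝ) := by
  rw [mem_hyperplane_input, orbit_input P a hx, Finset.prod_eq_zero_iff]
  simp [add_eq_zero_iff_eq_neg']

theorem orbit_input_injective {x : Fin (dim n) → ℝ}
    (hx : ∀ T, x (coord n T) = ∏ i ∈ T, x (coord n {i})) :
    Function.Injective ((input n P a).orbit x) := by
  intro s t h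
  have := congrFun h (coord n {0})
  rw [orbit_input P a hx, orbit_input P a hx] at this
  simpa using this

theorem meetsInAtLeast_input_iff :
    (input n P a).MeetsInAtLeast ↔ (input n P a).HitsAtLeast := by
  refine exists_congr fun x => and_congr_right fun h => ?_
  have hx := ((mem_initialSet_input P a x).1 h).2.2.1
  rw [Set.inter_comm, ← Set.image_preimage_eq_inter_range,
    (orbit_input_injective P a hx).encard_image]
  rfl

/-- The natural numbers among the `y i` form a subset of a set with exactly `k` elements; having `k`
of them leaves no other values. -/
theorem encard_hits {k : ℕ} {y : Fin k → ℝ} (hy : Function.Injective y) :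
    (k : ℕ∞) ≤ {t : ℕ | ∃ i, y i = t}.encard ↔ ∀ i, ∃ t : ℕ, y i = t := by
  have h1 : (Set.range y).encard = k := by simp [← Set.image_univ, hy.encard_image]
  have h2 : ((Nat.cast : ℕ → ℝ) '' {t : ℕ | ∃ i, y i = t}).encard =
    {t : ℕ | ∃ i, y i = t}.encard := Nat.cast_injective.encard_image _
  have h3 : (Nat.cast : ℕ → ℝ) '' {t : ℕ | ∃ i, y i = t} ⊆ Set.range y := by
    rintro _ ⟨t, ⟨i, hi⟩, rfl⟩
    exact ⟨i, hi⟩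
  rw [← h2, ← h1]
  constructor
  · intro h i
    have he := ((Set.finite_range y).subset h3).eq_of_subset_of_encard_le h3 h
    obtain ⟨t, -, ht⟩ := he.symm ▸ Set.mem_range_self i
    exact ⟨t, ht.symm⟩
  · refine fun h => Set.encard_le_encard ?_
    rintro _ ⟨i, rfl⟩
    obtain ⟨t, ht⟩ := h i
    exact ⟨t, ⟨i, ht⟩, ht.symm⟩

theorem hitsAtLeast_input_iff :
    (input n P a).HitsAtLeast ↔ ∃ t : Fin n → ℕ,
      aeval (Sum.elim (fun _ => (a : ℝ)) (fun i => (t i : ℝ))) P = 0 := by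
  -- The points of the initial set correspond to the sequences `y` through `x (coord n {i}) = -y i`.
  have key : (input n P a).HitsAtLeast ↔ ∃ y : Fin (n + 1) → ℝ, y 0 = a + 1 ∧ StrictMono y ∧
      aeval (Sum.elim (fun _ => (a : ℝ)) (fun i : Fin n => y i.succ - y i.castSucc - 1)) P = 0 ∧
      ∀ i, ∃ t : ℕ, y i = t := by
    constructor
    · rintro ⟨x, hx, hk⟩
      obtain ⟨h0, hP, hT, hlt⟩ := (mem_initialSet_input P a x).1 hx
      have hm : StrictMono fun i => -x (coord n {i}) :=
        Fin.strictMono_iff_lt_succ.2 fun i => neg_lt_neg (hlt i)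
      refine ⟨fun i => -x (coord n {i}), by simp [h0], hm, ?_, ?_⟩
      · rw [← hP, h0]
        congr 2
        ext (i | i) <;> simp
        ring
      · rw [← encard_hits hm.injective]
        simpa only [orbit_input_mem_hyperplane P a hT, neg_eq_iff_eq_neg] using hk
    · rintro ⟨y, h0, hm, hP, ht⟩
      obtain ⟨x, hT⟩ : ∃ x : Fin (dim n) → ℝ, ∀ T, x (coord n T) = ∏ i ∈ T, -y i :=
        ⟨fun j => ∏ i ∈ (coord n).symm j, -y i, fun T => by simp⟩
      have hS : ∀ i, x (coord n {i}) = -y i := fun i => by simp [hT]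
      refine ⟨x, (mem_initialSet_input P a _).2 ?_, ?_⟩
      · simp only [hS]
        refine ⟨by rw [h0], ?_, hT, fun i => neg_lt_neg (hm i.castSucc_lt_succ)⟩
        rw [← hP, h0]
        congr 2
        ext (i | i) <;> simp
        ring
      · rw [← encard_hits hm.injective] at ht
        have hx : ∀ T, x (coord n T) = ∏ i ∈ T, x (coord n {i}) := fun T => by simp only [hS, hT T]
        simpa only [orbit_input_mem_hyperplane P a hx, hS, neg_inj] using ht
  rw [key]
  constructor
  · rintro ⟨y, h0, hm, hP, ht⟩
    choose s hs using ht
    refine ⟨fun i => s i.succ - s i.castSucc - 1, ?_⟩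
    rw [← hP]
    congr 2
    ext (i | i)
    · simp
    · have h : s i.castSucc < s i.succ := by
        have := hm i.castSucc_lt_succ
        rw [hs, hs] at this
        exact_mod_cast this
      simp only [Sum.elim_inr, hs]
      rw [Nat.cast_sub (by omega), Nat.cast_sub h.le, Nat.cast_one]
  · rintro ⟨t, ht⟩
    -- The gaps are `t j + 1`, so the sequence increases strictly even where `t j = 0`.
    let s : Fin (n + 1) → ℕ := fun i => a + 1 + ∑ j : Fin n with j.castSucc < i, (t j + 1)
    have hs : ∀ i : Fin n, s i.succ = s i.castSucc + (t i + 1) := by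
      intro i
      have : (Finset.univ.filter fun j : Fin n => j.castSucc < i.succ) =
          insert i (Finset.univ.filter fun j : Fin n => j.castSucc < i.castSucc) := by
        ext j
        simp only [Finset.mem_filter, Finset.mem_univ, true_and, Finset.mem_insert, Fin.lt_def,
          Fin.ext_iff, Fin.val_castSucc, Fin.val_succ]
        omega
      simp only [s, this]
      rw [Finset.sum_insert (by simp)]
      ring
    refine ⟨fun i => s i, by simp [s], Fin.strictMono_iff_lt_succ.2 fun i => ?_, ?_,
      fun i => ⟨_, rfl⟩⟩
    · rw [hs]
      push_cast
      linarith [(Nat.cast_nonneg (t i) : (0 : ℝ) ≤ t i)]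
    · rw [← ht]
      congr 2
      ext (i | i)
      · simp
      · simp [hs]

end Reduction

/-! ### Undecidability from the halting problem. -/

theorem partrec_eval_ofNat :
    Nat.Partrec fun a => (Denumerable.ofNat Nat.Partrec.Code a).eval 0 :=
  Partrec.nat_iff.1 <| Nat.Partrec.Code.eval_part.comp (Computable.ofNat _) (Computable.const 0)

theorem not_decidableFor_of_reduction {V Q : Input → Prop} (g : ℕ → Input) (hg : Computable g)
    (hV : ∀ a, V (g a))
    (hQ : ∀ a, Q (g a) ↔ ((Denumerable.ofNat Nat.Partrec.Code a).eval 0).Dom) :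
    ¬ DecidableFor V Q := by
  rintro ⟨f, hf, h⟩
  refine ComputablePred.halting_problem 0 (ComputablePred.computable_iff.2
    ⟨fun c => f (g (Encodable.encode c)), hf.comp (hg.comp Computable.encode), ?_⟩)
  ext c
  rw [h _ (hV _), hQ, Denumerable.ofNat_encode]

end OrbitHits

theorem theorem6 :
    (¬ OrbitHits.DecidableFor OrbitHits.Input.WellFormed OrbitHits.Input.HitsAtLeast) ∧
    (¬ OrbitHits.DecidableFor OrbitHits.Input.WellFormed OrbitHits.Input.MeetsInAtLeast) ∧
    (¬ OrbitHits.DecidableFor (fun I => I.WellFormed ∧ I.Homogeneous)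
        OrbitHits.Input.HitsAtLeast) ∧
    (¬ OrbitHits.DecidableFor (fun I => I.WellFormed ∧ I.Homogeneous)
        OrbitHits.Input.MeetsInAtLeast) := by
  obtain ⟨n, P, hP⟩ := exists_mvPolynomial_of_partrec OrbitHits.partrec_eval_ofNat
  have hc := OrbitHits.Reduction.computable_input n P
  have hw := OrbitHits.Reduction.wellFormed_input P
  have h0 := OrbitHits.Reduction.homogeneous_input P
  have hh := fun a => (OrbitHits.Reduction.hitsAtLeast_input_iff P a).trans (hP a).symm
  have hm := fun a => (OrbitHits.Reduction.meetsInAtLeast_input_iff P a).trans (hh a)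
  exact ⟨OrbitHits.not_decidableFor_of_reduction _ hc hw hh,
    OrbitHits.not_decidableFor_of_reduction _ hc hw hm,
    OrbitHits.not_decidableFor_of_reduction _ hc (fun a => ⟨hw a, h0 a⟩) hh,
    OrbitHits.not_decidableFor_of_reduction _ hc (fun a => ⟨hw a, h0 a⟩) hm⟩
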